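/- \textbf{Setting.} A $*$-autonomous category is a symmetric monoidal category $(\mathtt C,\otimes,\mathbf 1)$ with a fully faithful functor $*\colon \mathtt C^{\rm op}\to\mathtt C$ and natural bijections $\mathtt C(a\otimes b,c^*)\cong\mathtt C(a,(b\otimes c)^*)$. A \emph{stem} is a $*$-autonomous functor $\mathcal S\colon\mathtt C\to\mathtt{FVec}$ to the category of finite-dimensional real vector spaces, i.e. a symmetric strong monoidal functor with natural isomorphisms $\mathcal S(c^*)\cong\mathcal S(c)'$ (the dual space) that carry the above bijections to currying of linear maps. We write $\mathcal S(c\otimes d)=\mathcal S(c)\otimes\mathcal S(d)$, $\mathcal S(c^*)=\mathcal S(c)'$, $\mathcal S(\mathbf 1)=\mathcal S(\mathbf 1^*)=\mathbb R$. The \emph{intrinsic cones} are $A(c)=\{v\in\mathcal S(c)\mid \mathcal S(\varphi)(v)\geqslant 0\ \forall\varphi\in\mathtt C(c,\mathbf 1^*)\}$. A cone is \emph{proper} if it is closed, convex, sharp (contains no line) and has nonempty interior. For cones $K\subseteq V$, $L\subseteq W$, $K\underline\otimes L\subseteq V\otimes W$ is the convex cone generated by all $v\otimes w$ with $v\in K$,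 $w\in L$. An \emph{$\mathcal S$-system} $\mathcal G$ on a finite-dimensional space $X$ consists of closed convex cones $\mathcal G(c)\subseteq X\otimes\mathcal S(c)$, $c\in\mathtt C$, such that ${\rm id}_X\otimes\mathcal S(\varphi)$ maps $\mathcal G(c)$ into $\mathcal G(d)$ for all $\varphi\in\mathtt C(c,d)$. Inclusion of systems on the same space is level-wise. A linear map $\psi\colon X\to Y$ is \emph{completely positive} from $(\mathcal G,X)$ to $(\mathcal H,Y)$ if $\psi\otimes{\rm id}$ maps $\mathcal G(c)$ into $\mathcal H(c)$ for all $c$. The \emph{dual} system $\mathcal G^\vee$ on $X'$ is $\mathcal G^\vee(c)=\mathcal G(c^*)^\vee\subseteq X'\otimes\mathcal S(c)$. $\mathtt{Sys}_{\rm pr}(\mathcal S)$ is the category of \emph{proper} systems, i.e. those with $\mathcal G(\mathbf 1)$ full-dimensional and $\mathcal G(\mathbf 1^*)$ sharp, with completely positive maps as morphisms. The \emph{minimal tensor product} $\mathcal G\underline\otimes\mathcal H$ is the smallest $\mathcal S$-system on $X\otimes Y$ that contains $\mathcal G(c)\underline\otimes\mathcal H(d)$ at level $c\otimes d$ for all $c,d$;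 the \emph{maximal tensor product} is $\mathcal G\overline\otimes\mathcal H=(\mathcal G^\vee\underline\otimes\mathcal H^\vee)^\vee$, where $(X'\otimes Y')'=X\otimes Y$. A \emph{tensor product of proper $\mathcal S$-systems} is a functor $\otimes\colon\mathtt{Sys}_{\rm pr}(\mathcal S)\times\mathtt{Sys}_{\rm pr}(\mathcal S)\to\mathtt{Sys}_{\rm pr}(\mathcal S)$ which on underlying spaces and linear maps is the usual tensor product of vector spaces. It is \emph{self-dual} if $\mathcal G\otimes\mathcal H=(\mathcal G^\vee\otimes\mathcal H^\vee)^\vee$ for all proper $\mathcal G,\mathcal H$ (equivalently, $(\mathcal G\otimes\mathcal H)^\vee=\mathcal G^\vee\otimes\mathcal H^\vee$). \textbf{Theorem.} Let $\mathcal S\colon\mathtt C\to\mathtt{FVec}$ be a stem such that all intrinsic cones $A(c)$ are proper and $A(c)\underline\otimes A(d)\subseteq A(c\otimes d)$ for all $c,d\in\mathtt C$. Then there exists a self-dual tensor product $\otimes$ of proper $\mathcal S$-systems that lies between the minimal and the maximal one: $$\mathcal G\underline\otimes\mathcal H\subseteq\mathcal G\otimes\mathcal H\subseteq\mathcal G\overline\otimes\mathcal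 H\qquad\text{for all }\mathcal G,\mathcal H\in\mathtt{Sys}_{\rm pr}(\mathcal S).$$ -/

import Mathlib

open CategoryTheory MonoidalCategory Opposite
open scoped TensorProduct

universe u v

namespace ConeSys

noncomputable section

/-! ### Closed and proper cones in finite-dimensional real vector spaces

A finite-dimensional real vector space carries its canonical topology, which is `moduleTopology`. -/

section Cones

variable {V W : Type} [AddCommGroup V] [Module ℝ V] [AddCommGroup W] [Module ℝ W]

/-- The cone is topologically closed. -/
def ClosedCone (K : PointedCone ℝ V) : Prop :=
  @IsClosed V (moduleTopology ℝ V) (K : Set V)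

/-- The cone is full-dimensional: it has nonempty interior. -/
def FullCone (K : PointedCone ℝ V) : Prop :=
  (@interior V (moduleTopology ℝ V) (K : Set V)).Nonempty

/-- The cone is sharp: it contains no line through the origin. -/
def SharpCone (K : PointedCone ℝ V) : Prop :=
  ∀ x ∈ K, -x ∈ K → x = 0

/-- A proper cone: closed, sharp and with nonempty interior. -/
structure IsProperCone (K : PointedCone ℝ V) : Prop where
  closed : ClosedCone K
  sharp : SharpCone K
  full : FullCone K

lemma closedCone_comap (f : V →ₗ[ℝ] W) {K : PointedCone ℝ W} (hK : ClosedCone K) :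
    ClosedCone (K.comap f) := by
  let : TopologicalSpace V := moduleTopology ℝ V
  let : TopologicalSpace W := moduleTopology ℝ W
  have : IsModuleTopology ℝ V := ⟨rfl⟩
  have : IsModuleTopology ℝ W := ⟨rfl⟩
  have : ContinuousAdd W := IsModuleTopology.toContinuousAdd ℝ W
  exact IsClosed.preimage (IsModuleTopology.continuous_of_linearMap f) hK

lemma closedCone_dual (p : V →ₗ[ℝ] W →ₗ[ℝ] ℝ) (s : Set V) :
    ClosedCone (PointedCone.dual p s) := by
  let : TopologicalSpace W := moduleTopology ℝ W
  have : IsModuleTopology ℝ W := ⟨rfl⟩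
  exact PointedCone.isClosed_dual fun x => IsModuleTopology.continuous_of_linearMap (p x)

lemma closedCone_sInf (s : Set (PointedCone ℝ V)) (hs : ∀ K ∈ s, ClosedCone K) :
    ClosedCone (sInf s) := by
  let : TopologicalSpace V := moduleTopology ℝ V
  have : ((sInf s : PointedCone ℝ V) : Set V) = ⋂ K ∈ s, (K : Set V) := Submodule.coe_sInf s
  unfold ClosedCone
  rw [this]
  exact isClosed_biInter hs

lemma fullCone_equiv_map (e : V ≃ₗ[ℝ] W) {K : PointedCone ℝ V} {L : PointedCone ℝ W}
    (h : ∀ x ∈ K, e x ∈ L) (hK : FullCone K) : FullCone L := by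
  let : TopologicalSpace V := moduleTopology ℝ V
  let : TopologicalSpace W := moduleTopology ℝ W
  have : IsModuleTopology ℝ V := ⟨rfl⟩
  have : IsModuleTopology ℝ W := ⟨rfl⟩
  have : ContinuousAdd V := IsModuleTopology.toContinuousAdd ℝ V
  have hc : Continuous e.symm := IsModuleTopology.continuous_of_linearMap e.symm.toLinearMap
  obtain ⟨x, hx⟩ := hK
  refine ⟨e x, ?_⟩
  change e x ∈ interior (L : Set W)
  have hx' : x ∈ interior (K : Set V) := hx
  refine mem_interior.2 ⟨e.symm ⁻¹' interior (K : Set V), ?_, isOpen_interior.preimage hc, ?_⟩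
  · intro y hy
    have := h _ (interior_subset hy)
    simpa using this
  · simpa using hx'

variable [Module.Finite ℝ V] [Module.Finite ℝ W]

lemma fullCone_iff_span (K : PointedCone ℝ V) :
    FullCone K ↔ Submodule.span ℝ (K : Set V) = ⊤ := by
  let e : V ≃ₗ[ℝ] (Fin (Module.finrank ℝ V) → ℝ) := (Module.finBasis ℝ V).equivFun
  have h1 : FullCone K ↔ FullCone (K.map e.toLinearMap) :=
    ⟨fullCone_equiv_map e fun x hx => ⟨x, hx, rfl⟩, fullCone_equiv_map e.symm (by
      rintro _ ⟨x, hx, rfl⟩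
      simpa using hx)⟩
  have h2 : FullCone (K.map e.toLinearMap) ↔
      (interior ((K.map e.toLinearMap : PointedCone ℝ (Fin (Module.finrank ℝ V) → ℝ)) :
      Set (Fin (Module.finrank ℝ V) → ℝ))).Nonempty := by
    unfold FullCone
    rw [← eq_moduleTopology ℝ (Fin (Module.finrank ℝ V) → ℝ)]
  have h0 : (0 : Fin (Module.finrank ℝ V) → ℝ) ∈
      ((K.map e.toLinearMap : PointedCone ℝ (Fin (Module.finrank ℝ V) → ℝ)) :
      Set (Fin (Module.finrank ℝ V) → ℝ)) := Submodule.zero_mem _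
  rw [h1, h2, (PointedCone.convex _).interior_nonempty_iff_affineSpan_eq_top,
    ← Set.insert_eq_of_mem h0, ← SetLike.coe_set_eq, affineSpan_insert_zero,
    PointedCone.coe_map]
  change ((Submodule.span ℝ (e.toLinearMap '' (K : Set V)) :
      Submodule ℝ (Fin (Module.finrank ℝ V) → ℝ)) : Set (Fin (Module.finrank ℝ V) → ℝ)) =
    Set.univ ↔ _
  rw [← Submodule.map_span, ← Submodule.top_coe (R := ℝ), SetLike.coe_set_eq]
  constructor
  · intro h
    apply Submodule.map_injective_of_injective e.injective
    rw [h, Submodule.map_top, LinearMap.range_eq_top.2 e.surjective]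
  · intro h
    rw [h, Submodule.map_top, LinearMap.range_eq_top.2 e.surjective]

lemma exists_functional_of_notMem {K : PointedCone ℝ V} (hK : ClosedCone K) {x : V} (hx : x ∉ K) :
    ∃ f : Module.Dual ℝ V, (∀ y ∈ K, 0 ≤ f y) ∧ f x < 0 := by
  let e : V ≃ₗ[ℝ] (Fin (Module.finrank ℝ V) → ℝ) := (Module.finBasis ℝ V).equivFun
  have hc : ClosedCone (K.comap e.symm.toLinearMap) := closedCone_comap _ hK
  unfold ClosedCone at hc
  rw [← eq_moduleTopology ℝ (Fin (Module.finrank ℝ V) → ℝ)] at hc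
  obtain ⟨f, hf, hfx⟩ := _root_.ProperCone.hyperplane_separation_point
    (⟨K.comap e.symm.toLinearMap, hc⟩ : _root_.ProperCone ℝ (Fin (Module.finrank ℝ V) → ℝ))
    (x₀ := e x) (by
      intro h
      apply hx
      have h' : e.symm (e x) ∈ K := h
      simpa using h')
  refine ⟨f.toLinearMap ∘ₗ e.toLinearMap, fun y hy => hf (e y) ?_, hfx⟩
  change e.symm (e y) ∈ K
  simpa using hy

lemma fullCone_dual (p : V →ₗ[ℝ] W →ₗ[ℝ] ℝ) (hp : Function.Bijective p)
    {K : PointedCone ℝ V} (hc : ClosedCone K) (hs : SharpCone K) :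
    FullCone (PointedCone.dual p (K : Set V)) := by
  rw [fullCone_iff_span]
  by_contra h
  obtain ⟨f, hf0, hf⟩ := Submodule.exists_le_ker_of_lt_top _ (lt_top_iff_ne_top.2 h)
  obtain ⟨x, rfl⟩ := hp.2 f
  have hpf : Function.Bijective p.flip := by
    let e : V ≃ₗ[ℝ] Module.Dual ℝ W := LinearEquiv.ofBijective p hp
    have hE : p.flip = e.dualMap.toLinearMap ∘ₗ (Module.evalEquiv ℝ W).toLinearMap := by
      ext w v
      simp [e]
    rw [hE]
    exact ((Module.evalEquiv ℝ W).trans e.dualMap).bijective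
  have key : ∀ z : V, (∀ w ∈ PointedCone.dual p (K : Set V), p z w = 0) → z ∈ K := by
    intro z hz
    by_contra hzK
    obtain ⟨g, hg, hgz⟩ := exists_functional_of_notMem hc hzK
    obtain ⟨w, rfl⟩ := hpf.2 g
    have h0 := hz w (fun v hv => hg v hv)
    rw [LinearMap.flip_apply, h0] at hgz
    exact lt_irrefl _ hgz
  have hx : ∀ w ∈ PointedCone.dual p (K : Set V), p x w = 0 := fun w hw =>
    hf (Submodule.subset_span hw)
  have : x = 0 := hs x (key x hx) (key (-x) fun w hw => by simp [hx w hw])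
  exact hf0 (by rw [this, map_zero])

lemma sharpCone_dual (p : V →ₗ[ℝ] W →ₗ[ℝ] ℝ) (hp : Function.Surjective p)
    {K : PointedCone ℝ V} (hK : FullCone K) : SharpCone (PointedCone.dual p (K : Set V)) := by
  intro w hw hw'
  rw [fullCone_iff_span] at hK
  have h0 : ∀ v, p v w = 0 := by
    have : Submodule.span ℝ (K : Set V) ≤ LinearMap.ker (p.flip w) := by
      rw [Submodule.span_le]
      intro v hv
      have h1 := hw hv
      have h2 := hw' hv
      rw [map_neg] at h2
      exact le_antisymm (neg_nonneg.1 h2) h1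
    rw [hK] at this
    exact fun v => this (Submodule.mem_top (x := v))
  refine (Module.forall_dual_apply_eq_zero_iff ℝ w).1 fun f => ?_
  obtain ⟨v, rfl⟩ := hp f
  exact h0 v

end Cones

/-! ### `*`-autonomous categories and stems -/

/-- A `*`-autonomous category: a symmetric monoidal category with a fully faithful contravariant
duality functor `*` and natural bijections `C(a ⊗ b, c^*) ≃ C(a, (b ⊗ c)^*)`. -/
class StarAutonomous (C : Type u) [Category.{v} C] [MonoidalCategory C] [SymmetricCategory C] where
  star : Cᵒᵖ ⥤ C
  full : star.Full
  faithful : star.Faithful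
  homEquiv (a b c : C) : (a ⊗ b ⟶ star.obj (op c)) ≃ (a ⟶ star.obj (op (b ⊗ c)))
  homEquiv_naturality {a a' b b' c c' : C} (f : a' ⟶ a) (g : b' ⟶ b) (h : c' ⟶ c)
    (k : a ⊗ b ⟶ star.obj (op c)) :
    homEquiv a' b' c' ((f ⊗ₘ g) ≫ k ≫ star.map h.op) =
      f ≫ homEquiv a b c k ≫ star.map (g ⊗ₘ h).op

section

variable {C : Type u} [Category.{v} C] [MonoidalCategory C] [SymmetricCategory C]
  [StarAutonomous C]

/-- The dual object `c^*`. -/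
def starObj (c : C) : C := StarAutonomous.star.obj (op c)

/-- The dual morphism `f^* : d^* ⟶ c^*` of `f : c ⟶ d`. -/
def starMap {c d : C} (f : c ⟶ d) : starObj d ⟶ starObj c := StarAutonomous.star.map f.op

/-- The bijection `C(a ⊗ b, c^*) ≃ C(a, (b ⊗ c)^*)`. -/
def starCurry (a b c : C) : (a ⊗ b ⟶ starObj c) ≃ (a ⟶ starObj (b ⊗ c)) :=
  StarAutonomous.homEquiv a b c

end

/-- The linear map underlying a morphism of finite-dimensional vector spaces. -/
abbrev linMap {V W : FGModuleCat.{0} ℝ} (f : V ⟶ W) : V →ₗ[ℝ] W := f.hom.hom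

/-- The tensorator `F c ⊗ F d ≃ F (c ⊗ d)` of a monoidal functor, as a linear equivalence. -/
def mulEquiv {C : Type u} [Category.{v} C] [MonoidalCategory C] (F : C ⥤ FGModuleCat.{0} ℝ)
    [F.Monoidal] (c d : C) : (F.obj c ⊗[ℝ] F.obj d) ≃ₗ[ℝ] F.obj (c ⊗ d) :=
  FGModuleCat.isoToLinearEquiv (Functor.Monoidal.μIso F c d)

/-- The vector of `F 𝟙` that corresponds to `1 : ℝ` under the unit isomorphism of a monoidal
functor. -/
def oneVec {C : Type u} [Category.{v} C] [MonoidalCategory C] (F : C ⥤ FGModuleCat.{0} ℝ)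
    [F.Monoidal] : F.obj (𝟙_ C) :=
  linMap (Functor.LaxMonoidal.ε F) (1 : ℝ)

/-- A stem: a `*`-autonomous functor from `C` to the category of finite-dimensional real vector
spaces, that is, a symmetric strong monoidal functor with natural isomorphisms
`S (c^*) ≃ (S c)'` under which the bijections `C(a ⊗ b, c^*) ≃ C(a, (b ⊗ c)^*)` become currying of
linear maps. -/
structure Stem (C : Type u) [Category.{v} C] [MonoidalCategory C] [SymmetricCategory C]
    [StarAutonomous C] where
  functor : C ⥤ FGModuleCat.{0} ℝ
  braided : functor.Braided
  dualEquiv (c : C) : functor.obj (starObj c) ≃ₗ[ℝ] Module.Dual ℝ (functor.obj c)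
  dualEquiv_naturality {c d : C} (f : c ⟶ d) (y : functor.obj (starObj d)) (x : functor.obj c) :
    dualEquiv c (linMap (functor.map (starMap f)) y) x = dualEquiv d y (linMap (functor.map f) x)
  dualEquiv_starCurry {a b c : C} (f : a ⊗ b ⟶ starObj c)
    (x : functor.obj a) (y : functor.obj b) (z : functor.obj c) :
    dualEquiv (b ⊗ c) (linMap (functor.map (starCurry a b c f)) x)
        (mulEquiv functor b c (y ⊗ₜ[ℝ] z)) =
      dualEquiv c (linMap (functor.map f) (mulEquiv functor a b (x ⊗ₜ[ℝ] y))) z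

attribute [instance] Stem.braided

variable {C : Type u} [Category.{v} C] [MonoidalCategory C] [SymmetricCategory C]
  [StarAutonomous C] (S : Stem C)

namespace Stem

/-- The space `S c`. -/
abbrev obj (c : C) : FGModuleCat.{0} ℝ := S.functor.obj c

/-- The linear map `S φ`. -/
abbrev map {c d : C} (φ : c ⟶ d) : S.obj c →ₗ[ℝ] S.obj d := linMap (S.functor.map φ)

/-- The identification `S c ⊗ S d ≃ S (c ⊗ d)`. -/
abbrev mul (c d : C) : (S.obj c ⊗[ℝ] S.obj d) ≃ₗ[ℝ] S.obj (c ⊗ d) := mulEquiv S.functor c d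

/-- The element `1` of `S 𝟙 ≃ ℝ`. -/
abbrev one : S.obj (𝟙_ C) := oneVec S.functor

/-- The identification of `S (𝟙^*) ≃ (S 𝟙)'` with `ℝ`. -/
def toReal : S.obj (starObj (𝟙_ C)) →ₗ[ℝ] ℝ :=
  Module.Dual.eval ℝ (S.obj (𝟙_ C)) S.one ∘ₗ (S.dualEquiv (𝟙_ C)).toLinearMap

/-- The intrinsic cone `A(c)`: all `v : S c` with `S φ v ≥ 0` for every `φ : c ⟶ 𝟙^*`. -/
def intrinsicCone (c : C) : PointedCone ℝ (S.obj c) where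
  carrier := {v | ∀ φ : c ⟶ starObj (𝟙_ C), 0 ≤ S.toReal (S.map φ v)}
  add_mem' hx hy φ := by
    rw [map_add, map_add]; exact add_nonneg (hx φ) (hy φ)
  zero_mem' φ := by rw [map_zero, map_zero]
  smul_mem' r x hx φ := by
    have h := mul_nonneg r.2 (hx φ)
    have e : S.toReal (S.map φ (r • x)) = (r : ℝ) * S.toReal (S.map φ x) := by
      change S.toReal (S.map φ ((r : ℝ) • x)) = _
      rw [map_smul, map_smul, smul_eq_mul]
    rw [e]; exact h

end Stem

/-! ### Systems -/

/-- An `S`-system on `X`: closed convex cones in the spaces `X ⊗ S c`, such that `id_X ⊗ S φ` maps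
the cone at level `c` into the cone at level `d` for every `φ : c ⟶ d`. -/
structure System (X : Type) [AddCommGroup X] [Module ℝ X] where
  cone (c : C) : PointedCone ℝ (X ⊗[ℝ] S.obj c)
  closed (c : C) : ClosedCone (cone c)
  map_mem {c d : C} (φ : c ⟶ d) {z : X ⊗[ℝ] S.obj c} (hz : z ∈ cone c) :
    (S.map φ).lTensor X z ∈ cone d

namespace System

variable {S} {X Y Z : Type} [AddCommGroup X] [Module ℝ X] [AddCommGroup Y] [Module ℝ Y]
  [AddCommGroup Z] [Module ℝ Z]

/-- Level-wise inclusion of systems on the same space. -/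
instance : LE (System S X) := ⟨fun G H => ∀ c, G.cone c ≤ H.cone c⟩

/-- A linear map `ψ : X → Y` is completely positive with respect to `G` and `H` if `ψ ⊗ id` maps
`G(c)` into `H(c)` for every `c`. -/
def CompletelyPositive (G : System S X) (H : System S Y) (ψ : X →ₗ[ℝ] Y) : Prop :=
  ∀ (c : C), ∀ z ∈ G.cone c, ψ.rTensor (S.obj c) z ∈ H.cone c

/-- The largest system on `X` for which `ψ` is completely positive into `H`. -/
def comap (ψ : X →ₗ[ℝ] Y) (H : System S Y) : System S X where
  cone c := (H.cone c).comap (ψ.rTensor (S.obj c))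
  closed c := closedCone_comap _ (H.closed c)
  map_mem {c d} φ z hz := by
    have h := H.map_mem φ hz
    change ψ.rTensor (S.obj d) ((S.map φ).lTensor X z) ∈ H.cone d
    rwa [← LinearMap.comp_apply, LinearMap.rTensor_comp_lTensor, ← LinearMap.lTensor_comp_rTensor]

end System

/-- The pairing of `X ⊗ S (c^*)` with `X' ⊗ S c`, given by
`⟨x ⊗ u, f ⊗ s⟩ = f x * ⟨u, s⟩`. -/
def Stem.pairing (X : Type) [AddCommGroup X] [Module ℝ X] (c : C) :
    (X ⊗[ℝ] S.obj (starObj c)) →ₗ[ℝ] (Module.Dual ℝ X ⊗[ℝ] S.obj c) →ₗ[ℝ] ℝ :=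
  TensorProduct.dualDistrib ℝ (Module.Dual ℝ X) (S.obj c) ∘ₗ
    TensorProduct.map (Module.Dual.eval ℝ X) (S.dualEquiv c).toLinearMap

@[simp] lemma Stem.pairing_tmul (X : Type) [AddCommGroup X] [Module ℝ X] (c : C) (x : X)
    (u : S.obj (starObj c)) (f : Module.Dual ℝ X) (s : S.obj c) :
    S.pairing X c (x ⊗ₜ u) (f ⊗ₜ s) = f x * S.dualEquiv c u s := by
  simp [Stem.pairing]

lemma Stem.pairing_map (X : Type) [AddCommGroup X] [Module ℝ X] {c d : C} (φ : c ⟶ d)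
    (w : X ⊗[ℝ] S.obj (starObj d)) (z : Module.Dual ℝ X ⊗[ℝ] S.obj c) :
    S.pairing X c ((S.map (starMap φ)).lTensor X w) z =
      S.pairing X d w ((S.map φ).lTensor (Module.Dual ℝ X) z) := by
  induction w with
  | zero => simp
  | add a b ha hb => simp only [map_add, LinearMap.add_apply, ha, hb]
  | tmul x u =>
    induction z with
    | zero => simp
    | add a b ha hb => simp only [map_add, ha, hb]
    | tmul f s =>
      rw [LinearMap.lTensor_tmul, LinearMap.lTensor_tmul, S.pairing_tmul, S.pairing_tmul,
        S.dualEquiv_naturality]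

namespace System

variable {S} {X Y : Type} [AddCommGroup X] [Module ℝ X] [AddCommGroup Y] [Module ℝ Y]

/-- The dual system on `X'`: its cone at level `c` is the dual of the cone at level `c^*`. -/
def dual (G : System S X) : System S (Module.Dual ℝ X) where
  cone c := PointedCone.dual (S.pairing X c) (G.cone (starObj c))
  closed c := closedCone_dual _ _
  map_mem {c d} φ z hz w hw := by
    rw [← S.pairing_map]
    exact hz (G.map_mem (starMap φ) hw)

end System

/-- The canonical map `(X ⊗ S c) ⊗ (Y ⊗ S d) → (X ⊗ Y) ⊗ S (c ⊗ d)`. -/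
def Stem.mulTensor (X Y : Type) [AddCommGroup X] [Module ℝ X] [AddCommGroup Y] [Module ℝ Y]
    (c d : C) : ((X ⊗[ℝ] S.obj c) ⊗[ℝ] (Y ⊗[ℝ] S.obj d)) →ₗ[ℝ] (X ⊗[ℝ] Y) ⊗[ℝ] S.obj (c ⊗ d) :=
  (S.mul c d).toLinearMap.lTensor (X ⊗[ℝ] Y) ∘ₗ
    (TensorProduct.tensorTensorTensorComm ℝ X (S.obj c) Y (S.obj d)).toLinearMap

namespace System

variable {S} {X Y : Type} [AddCommGroup X] [Module ℝ X] [AddCommGroup Y] [Module ℝ Y]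

/-- `K` contains the minimal tensor products of the cones of `G` and `H`, that is,
`G(c) ⊗ H(d) ⊆ K(c ⊗ d)` for all `c` and `d`. -/
def ContainsProducts (G : System S X) (H : System S Y) (K : System S (X ⊗[ℝ] Y)) : Prop :=
  ∀ c d : C, ((G.cone c).minTensorProduct (H.cone d)).map (S.mulTensor X Y c d) ≤ K.cone (c ⊗ d)

/-- The minimal tensor product of systems: the smallest system on `X ⊗ Y` which contains the
minimal tensor products of all cones of `G` and `H`. -/
def minTensor (G : System S X) (H : System S Y) : System S (X ⊗[ℝ] Y) where
  cone c := sInf {L | ∃ K : System S (X ⊗[ℝ] Y), ContainsProducts G H K ∧ L = K.cone c}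
  closed c := closedCone_sInf _ (by rintro _ ⟨K, -, rfl⟩; exact K.closed c)
  map_mem {c d} φ z hz := by
    refine Submodule.mem_sInf.2 ?_
    rintro _ ⟨K, hK, rfl⟩
    exact K.map_mem φ (Submodule.mem_sInf.1 hz _ ⟨K, hK, rfl⟩)

lemma isLeast_minTensor (G : System S X) (H : System S Y) :
    IsLeast {K | ContainsProducts G H K} (minTensor G H) := by
  refine ⟨fun c d => le_sInf ?_, fun K hK c => sInf_le ⟨K, hK, rfl⟩⟩
  rintro _ ⟨K, hK, rfl⟩
  exact hK c d

end System

/-- The canonical map `X ⊗ Y → (X' ⊗ Y')'`, an isomorphism for finite-dimensional spaces. -/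
def tensorBidual (X Y : Type) [AddCommGroup X] [Module ℝ X] [AddCommGroup Y] [Module ℝ Y] :
    (X ⊗[ℝ] Y) →ₗ[ℝ] Module.Dual ℝ (Module.Dual ℝ X ⊗[ℝ] Module.Dual ℝ Y) :=
  TensorProduct.dualDistrib ℝ (Module.Dual ℝ X) (Module.Dual ℝ Y) ∘ₗ
    TensorProduct.map (Module.Dual.eval ℝ X) (Module.Dual.eval ℝ Y)

namespace System

variable {S} {X Y : Type} [AddCommGroup X] [Module ℝ X] [AddCommGroup Y] [Module ℝ Y]

/-- The maximal tensor product of systems: the dual `(G^∨ ⊗ H^∨)^∨` of the minimal tensor product,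
where `X ⊗ Y` is identified with `(X' ⊗ Y')'`. -/
def maxTensor (G : System S X) (H : System S Y) : System S (X ⊗[ℝ] Y) :=
  comap (tensorBidual X Y) (minTensor G.dual H.dual).dual

/-- A proper system: its cone at level `𝟙` is full-dimensional and its cone at level `𝟙^*` is
sharp. -/
structure Proper (G : System S X) : Prop where
  full : FullCone (G.cone (𝟙_ C))
  sharp : SharpCone (G.cone (starObj (𝟙_ C)))

end System

/-! ### Properness of the dual system -/

/-- The canonical morphism `𝟙 ⟶ 𝟙^**`. -/
def unitToBidual (C : Type u) [Category.{v} C] [MonoidalCategory C] [SymmetricCategory C]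
    [StarAutonomous C] : 𝟙_ C ⟶ starObj (starObj (𝟙_ C)) :=
  starCurry (𝟙_ C) (starObj (𝟙_ C)) (𝟙_ C) (λ_ (starObj (𝟙_ C))).hom ≫
    starMap (ρ_ (starObj (𝟙_ C))).inv

namespace Stem

lemma mul_one_left (c : C) (x : S.obj c) :
    S.map (λ_ c).hom (S.mul (𝟙_ C) c (S.one ⊗ₜ[ℝ] x)) = x := by
  have h := congrArg linMap (Functor.LaxMonoidal.left_unitality S.functor c)
  have h1 := LinearMap.congr_fun h ((1 : ℝ) ⊗ₜ[ℝ] x)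
  have h2 : linMap (λ_ (S.functor.obj c)).hom ((1 : ℝ) ⊗ₜ[ℝ] x) = (1 : ℝ) • x := rfl
  rw [h2, one_smul] at h1
  exact h1.symm

lemma mul_one_right (c : C) (x : S.obj c) :
    S.mul c (𝟙_ C) (x ⊗ₜ[ℝ] S.one) = S.map (ρ_ c).inv x := by
  have h := congrArg linMap (Functor.LaxMonoidal.right_unitality S.functor c)
  have h1 := LinearMap.congr_fun h (x ⊗ₜ[ℝ] (1 : ℝ))
  have h2 : linMap (ρ_ (S.functor.obj c)).hom (x ⊗ₜ[ℝ] (1 : ℝ)) = (1 : ℝ) • x := rfl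
  rw [h2, one_smul] at h1
  have h3 : x = S.map (ρ_ c).hom (S.mul c (𝟙_ C) (x ⊗ₜ[ℝ] S.one)) := h1
  have h4 := congrArg linMap (S.functor.mapIso (ρ_ c)).hom_inv_id
  conv_rhs => rw [h3]
  exact (LinearMap.congr_fun h4 (S.mul c (𝟙_ C) (x ⊗ₜ[ℝ] S.one))).symm

lemma dualEquiv_unitToBidual (u : S.obj (starObj (𝟙_ C))) :
    S.dualEquiv (starObj (𝟙_ C)) (S.map (unitToBidual C) S.one) u = S.dualEquiv (𝟙_ C) u S.one := by
  have h := S.dualEquiv_starCurry (λ_ (starObj (𝟙_ C))).hom S.one u S.one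
  have h1 : S.map (unitToBidual C) S.one = S.map (starMap (ρ_ (starObj (𝟙_ C))).inv)
      (S.map (starCurry (𝟙_ C) (starObj (𝟙_ C)) (𝟙_ C) (λ_ (starObj (𝟙_ C))).hom) S.one) := by
    simp [unitToBidual, Stem.map, linMap]
  rw [h1, S.dualEquiv_naturality, ← S.mul_one_right, h, S.mul_one_left]

/-- The unit isomorphism `ℝ ≃ S 𝟙`. -/
def unitEquiv : ℝ ≃ₗ[ℝ] S.obj (𝟙_ C) :=
  FGModuleCat.isoToLinearEquiv (Functor.Monoidal.εIso S.functor)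

lemma unitEquiv_one : S.unitEquiv 1 = S.one := rfl

lemma bijective_map_unitToBidual : Function.Bijective (S.map (unitToBidual C)) := by
  have key : ∀ (x : S.obj (𝟙_ C)) (u : S.obj (starObj (𝟙_ C))),
      S.dualEquiv (starObj (𝟙_ C)) (S.map (unitToBidual C) x) u = S.dualEquiv (𝟙_ C) u x := by
    intro x u
    obtain ⟨r, rfl⟩ := S.unitEquiv.surjective x
    have hr : S.unitEquiv r = r • S.one := by
      rw [← S.unitEquiv_one, ← map_smul, smul_eq_mul, mul_one]
    rw [hr, map_smul, map_smul, map_smul, LinearMap.smul_apply, S.dualEquiv_unitToBidual]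
  have hinj : Function.Injective (S.map (unitToBidual C)) := by
    rw [injective_iff_map_eq_zero]
    intro x hx
    refine (Module.forall_dual_apply_eq_zero_iff ℝ x).1 fun f => ?_
    have := key x ((S.dualEquiv (𝟙_ C)).symm f)
    rw [hx, map_zero, LinearMap.zero_apply, LinearEquiv.apply_symm_apply] at this
    exact this.symm
  have hdim : Module.finrank ℝ (S.obj (𝟙_ C)) =
      Module.finrank ℝ (S.obj (starObj (starObj (𝟙_ C)))) := by
    rw [(S.dualEquiv (starObj (𝟙_ C))).finrank_eq, Subspace.dual_finrank_eq,
      (S.dualEquiv (𝟙_ C)).finrank_eq, Subspace.dual_finrank_eq]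
  exact ⟨hinj, (LinearMap.injective_iff_surjective_of_finrank_eq_finrank hdim).1 hinj⟩

lemma bijective_pairing (X : Type) [AddCommGroup X] [Module ℝ X] [Module.Finite ℝ X] (c : C) :
    Function.Bijective (S.pairing X c) := by
  have h : S.pairing X c = ((TensorProduct.congr (Module.evalEquiv ℝ X) (S.dualEquiv c)).trans
      (TensorProduct.dualDistribEquiv ℝ (Module.Dual ℝ X) (S.obj c))).toLinearMap := by
    ext
    simp [Stem.pairing]
  rw [h]
  exact LinearEquiv.bijective _

end Stem

namespace System

variable {S} {X Y : Type} [AddCommGroup X] [Module ℝ X] [AddCommGroup Y] [Module ℝ Y]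

lemma Proper.dual [Module.Finite ℝ X] {G : System S X} (hG : G.Proper) : G.dual.Proper where
  full := fullCone_dual _ (S.bijective_pairing X _) (G.closed _) hG.sharp
  sharp := by
    refine sharpCone_dual _ (S.bijective_pairing X _).2 ?_
    exact fullCone_equiv_map
      (LinearEquiv.lTensor X (LinearEquiv.ofBijective _ S.bijective_map_unitToBidual))
      (fun z hz => G.map_mem (unitToBidual C) hz) hG.full

end System

/-! ### The category of proper systems and its tensor products -/

/-- A proper `S`-system together with its underlying finite-dimensional space. -/
structure ProperSystem where
  space : FGModuleCat.{0} ℝ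
  system : System S space
  proper : system.Proper

variable {S}

/-- A morphism of proper systems: a completely positive linear map. -/
@[ext]
structure ProperSystem.Hom (G H : ProperSystem S) where
  linear : G.space →ₗ[ℝ] H.space
  cp : G.system.CompletelyPositive H.system linear

/-- The category `Sys_pr(S)` of proper systems and completely positive maps. -/
instance : Category (ProperSystem S) where
  Hom G H := ProperSystem.Hom G H
  id G := ⟨LinearMap.id, fun c z hz => by rwa [LinearMap.rTensor_id]⟩
  comp f g := ⟨g.linear ∘ₗ f.linear, fun c z hz => by
    rw [LinearMap.rTensor_comp]; exact g.cp c _ (f.cp c z hz)⟩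

variable (S) in
/-- The forgetful functor from proper systems to finite-dimensional spaces. -/
def ProperSystem.forget : ProperSystem S ⥤ FGModuleCat.{0} ℝ where
  obj G := G.space
  map f := FGModuleCat.ofHom f.linear

/-- The dual of a proper system. -/
def ProperSystem.dual (G : ProperSystem S) : ProperSystem S where
  space := FGModuleCat.of ℝ (Module.Dual ℝ G.space)
  system := G.system.dual
  proper := G.proper.dual

variable (S) in
/-- A tensor product of proper systems: it assigns to any two proper systems on `X` and `Y` a proper
system on `X ⊗ Y`, such that `φ ⊗ ψ` is completely positive whenever `φ` and `ψ` are. -/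
structure SystemTensorProduct where
  obj (G H : ProperSystem S) : System S (G.space ⊗[ℝ] H.space)
  proper (G H : ProperSystem S) : (obj G H).Proper
  map_cp {G G' H H' : ProperSystem S} (φ : G ⟶ G') (ψ : H ⟶ H') :
    (obj G H).CompletelyPositive (obj G' H') (TensorProduct.map φ.linear ψ.linear)

namespace SystemTensorProduct

/-- A tensor product of proper systems, as a functor `Sys_pr(S) × Sys_pr(S) ⥤ Sys_pr(S)`. -/
def toFunctor (T : SystemTensorProduct S) : ProperSystem S × ProperSystem S ⥤ ProperSystem S where
  obj P := ⟨FGModuleCat.of ℝ (P.1.space ⊗[ℝ] P.2.space), T.obj P.1 P.2, T.proper P.1 P.2⟩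
  map f := ⟨TensorProduct.map f.1.linear f.2.linear, T.map_cp f.1 f.2⟩
  map_id _ := ProperSystem.Hom.ext TensorProduct.map_id
  map_comp f g := ProperSystem.Hom.ext
    (TensorProduct.map_comp g.1.linear g.2.linear f.1.linear f.2.linear)

/-- The functor lies over the tensor product of the underlying spaces. -/
lemma toFunctor_forget (T : SystemTensorProduct S) :
    T.toFunctor ⋙ ProperSystem.forget S =
      (ProperSystem.forget S).prod (ProperSystem.forget S) ⋙ tensor (FGModuleCat.{0} ℝ) :=
  rfl

/-- The system that the dual tensor product assigns to `G` and `H`, namely `(G^∨ ⊗ H^∨)^∨`, where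
`X ⊗ Y` is identified with `(X' ⊗ Y')'`. -/
def dualObj (T : SystemTensorProduct S) (G H : ProperSystem S) :
    System S (G.space ⊗[ℝ] H.space) :=
  (T.obj G.dual H.dual).dual.comap (tensorBidual G.space H.space)

/-- A tensor product is self-dual if it equals its dual tensor product. -/
def SelfDual (T : SystemTensorProduct S) : Prop :=
  ∀ G H : ProperSystem S, T.obj G H = T.dualObj G H

end SystemTensorProduct

end

end ConeSys

open ConeSys

/-! The tensor product is obtained from Zorn's lemma, applied to all proper systems and all levels
at once. Consider elements `z` of spaces `(X ⊗ Y) ⊗ S c`, where `X` and `Y` underlie proper systems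
`G` and `H`. Two such elements are compatible if every pairing built from positive pairings `α`, `β`
of the systems and a morphism `χ : c ⟶ c'^*` is nonnegative on them.

Elementary products are pairwise compatible: contracting the two factors along `α` and `β` gives
elements of intrinsic cones, and the hypothesis on the cones `A(c)` makes their product nonnegative
(`tensorPairing_mulTensor_nonneg`, `isClique_products`). Hence a maximal clique `P` of pairwise
compatible, self-compatible elements contains all products, and its cones are generating.

The tensor product is `polar P`, the elements compatible with all of `P`. It is closed and
functorial, since completely positive maps pull positive pairings back to positive pairings. By
maximality, an element of `polar P` lies in `P` as soon as it is self-compatible; `mem_of_mem_polar`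
shows that it always is, by a halving argument that uses generation.

Self-duality (`polar_eq_dual`) follows because evaluation is a positive pairing of `G.dual` with
`G`, and because every positive pairing is evaluation after a completely positive map into the dual.
Properness and the upper bound are then dual to generation and the lower bound. -/

namespace ConeSys

noncomputable section

/-! ### Tensor products and contractions of bilinear pairings. -/

section BilinearForms

variable {V W V' W' X Y X' Y' : Type} [AddCommGroup V] [Module ℝ V] [AddCommGroup W] [Module ℝ W]
  [AddCommGroup V'] [Module ℝ V'] [AddCommGroup W'] [Module ℝ W']
  [AddCommGroup X] [Module ℝ X] [AddCommGroup Y] [Module ℝ Y]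
  [AddCommGroup X'] [Module ℝ X'] [AddCommGroup Y'] [Module ℝ Y']

/-- The tensor product of two bilinear pairings. -/
def tensorPairing (α : X →ₗ[ℝ] Y →ₗ[ℝ] ℝ) (γ : V →ₗ[ℝ] W →ₗ[ℝ] ℝ) :
    (X ⊗[ℝ] V) →ₗ[ℝ] (Y ⊗[ℝ] W) →ₗ[ℝ] ℝ :=
  (TensorProduct.map₂ α γ).compr₂ (LinearMap.mul' ℝ ℝ)

@[simp] lemma tensorPairing_tmul (α : X →ₗ[ℝ] Y →ₗ[ℝ] ℝ) (γ : V →ₗ[ℝ] W →ₗ[ℝ] ℝ) (x : X) (v : V)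
    (y : Y) (w : W) : tensorPairing α γ (x ⊗ₜ v) (y ⊗ₜ w) = α x y * γ v w := by
  simp [tensorPairing]

lemma tensorPairing_flip (α : X →ₗ[ℝ] Y →ₗ[ℝ] ℝ) (γ : V →ₗ[ℝ] W →ₗ[ℝ] ℝ) (z : X ⊗[ℝ] V)
    (w : Y ⊗[ℝ] W) : tensorPairing α.flip γ.flip w z = tensorPairing α γ z w := by
  have : (tensorPairing α.flip γ.flip).flip = tensorPairing α γ := by
    ext
    simp
  rw [← this, LinearMap.flip_apply]

lemma tensorPairing_map (α : X' →ₗ[ℝ] Y' →ₗ[ℝ] ℝ) (γ : V' →ₗ[ℝ] W' →ₗ[ℝ] ℝ) (f : X →ₗ[ℝ] X')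
    (g : V →ₗ[ℝ] V') (f' : Y →ₗ[ℝ] Y') (g' : W →ₗ[ℝ] W') (z : X ⊗[ℝ] V) (w : Y ⊗[ℝ] W) :
    tensorPairing α γ (TensorProduct.map f g z) (TensorProduct.map f' g' w) =
      tensorPairing (α.compl₁₂ f f') (γ.compl₁₂ g g') z w := by
  have : (tensorPairing α γ).compl₁₂ (TensorProduct.map f g) (TensorProduct.map f' g') =
      tensorPairing (α.compl₁₂ f f') (γ.compl₁₂ g g') := by
    ext
    simp
  rw [← this, LinearMap.compl₁₂_apply]

/-- The contraction of the first tensor factors along a bilinear pairing. -/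
def contract (α : X →ₗ[ℝ] Y →ₗ[ℝ] ℝ) : (X ⊗[ℝ] V) →ₗ[ℝ] (Y ⊗[ℝ] W) →ₗ[ℝ] V ⊗[ℝ] W :=
  (TensorProduct.map₂ α (TensorProduct.mk ℝ V W)).compr₂ (TensorProduct.lid ℝ (V ⊗[ℝ] W)).toLinearMap

@[simp] lemma contract_tmul (α : X →ₗ[ℝ] Y →ₗ[ℝ] ℝ) (x : X) (v : V) (y : Y) (w : W) :
    contract α (x ⊗ₜ v) (y ⊗ₜ w) = α x y • (v ⊗ₜ[ℝ] w) := by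
  simp [contract]

end BilinearForms

variable {C : Type u} [Category.{v} C] [MonoidalCategory C] [SymmetricCategory C]
  [StarAutonomous C] {S : Stem C}

/-! ### Morphisms into dual objects as bilinear pairings. -/

namespace Stem

variable (S)

lemma map_id_apply {c : C} (x : S.obj c) : S.map (𝟙 c) x = x := by
  simp [Stem.map, linMap]

lemma map_comp_apply {a b c : C} (f : a ⟶ b) (g : b ⟶ c) (x : S.obj a) :
    S.map (f ≫ g) x = S.map g (S.map f x) := by
  simp [Stem.map, linMap]

lemma map_braiding (c d : C) (x : S.obj c) (y : S.obj d) :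
    S.map (β_ c d).hom (S.mul c d (x ⊗ₜ[ℝ] y)) = S.mul d c (y ⊗ₜ[ℝ] x) := by
  have h := congrArg linMap (Functor.LaxBraided.braided (F := S.functor) c d)
  exact LinearMap.congr_fun h (x ⊗ₜ[ℝ] y)

lemma map_tensorμ (a b c d : C) (x : S.obj a) (y : S.obj b) (z : S.obj c) (w : S.obj d) :
    S.map (tensorμ a b c d) (S.mul _ _ (S.mul a b (x ⊗ₜ[ℝ] y) ⊗ₜ[ℝ] S.mul c d (z ⊗ₜ[ℝ] w))) =
      S.mul _ _ (S.mul a c (x ⊗ₜ[ℝ] z) ⊗ₜ[ℝ] S.mul b d (y ⊗ₜ[ℝ] w)) := by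
  have h := congrArg linMap (MonoidalCategory.tensorμ_comp_μ_tensorHom_μ_comp_μ S.functor a b c d)
  exact (LinearMap.congr_fun h ((x ⊗ₜ[ℝ] y) ⊗ₜ[ℝ] (z ⊗ₜ[ℝ] w))).symm

/-- The bilinear pairing of `S a` and `S b` induced by a morphism `a ⟶ b^*`. -/
def form {a b : C} (χ : a ⟶ starObj b) : S.obj a →ₗ[ℝ] S.obj b →ₗ[ℝ] ℝ :=
  (S.dualEquiv b).toLinearMap ∘ₗ S.map χ

lemma form_apply {a b : C} (χ : a ⟶ starObj b) (s : S.obj a) (t : S.obj b) :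
    S.form χ s t = S.dualEquiv b (S.map χ s) t := rfl

/-- Currying with third object `𝟙`, corrected by the right unitor. With `exists_uncurry`, it matches
the pairings `form χ` with the tests that define the intrinsic cone of `a ⊗ b`. -/
lemma exists_curry {a b : C} (θ : a ⊗ b ⟶ starObj (𝟙_ C)) : ∃ χ : a ⟶ starObj b,
    ∀ s t, S.form χ s t = S.toReal (S.map θ (S.mul a b (s ⊗ₜ[ℝ] t))) := by
  refine ⟨starCurry a b (𝟙_ C) θ ≫ starMap (ρ_ b).inv, fun s t => ?_⟩
  rw [form_apply, map_comp_apply, S.dualEquiv_naturality, ← S.mul_one_right,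
    S.dualEquiv_starCurry]
  rfl

lemma exists_uncurry {a b : C} (χ : a ⟶ starObj b) : ∃ θ : a ⊗ b ⟶ starObj (𝟙_ C),
    ∀ s t, S.form χ s t = S.toReal (S.map θ (S.mul a b (s ⊗ₜ[ℝ] t))) := by
  refine ⟨(starCurry a b (𝟙_ C)).symm (χ ≫ starMap (ρ_ b).hom), fun s t => ?_⟩
  have h := S.dualEquiv_starCurry ((starCurry a b (𝟙_ C)).symm (χ ≫ starMap (ρ_ b).hom)) s t S.one
  rw [Equiv.apply_symm_apply, map_comp_apply, S.dualEquiv_naturality, S.mul_one_right,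
    ← map_comp_apply, Iso.inv_hom_id, map_id_apply] at h
  exact h

/-- Uncurry, compose with the braiding, and curry again. This is the source of the symmetry of
positivity and compatibility. -/
lemma exists_form_flip {a b : C} (χ : a ⟶ starObj b) :
    ∃ χ' : b ⟶ starObj a, S.form χ' = (S.form χ).flip := by
  obtain ⟨θ, hθ⟩ := S.exists_uncurry χ
  obtain ⟨χ', h⟩ := S.exists_curry ((β_ b a).hom ≫ θ)
  refine ⟨χ', ?_⟩
  ext t s
  rw [h, map_comp_apply, map_braiding, LinearMap.flip_apply, hθ]

/-- A functional vanishing on all points `𝟙 ⟶ c` is a vector `u` of `S (c^*)`. Since `*` is full,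
every test `c^* ⟶ 𝟙^*` is the dual of such a point, so all tests vanish on `u`. Thus `u` and `-u`
lie in the intrinsic cone, and sharpness gives `u = 0`. -/
lemma span_range_map_one (c : C) (h : SharpCone (S.intrinsicCone (starObj c))) :
    Submodule.span ℝ (Set.range fun φ : 𝟙_ C ⟶ c => S.map φ S.one) = ⊤ := by
  by_contra hne
  obtain ⟨f, hf0, hf⟩ := Submodule.exists_le_ker_of_lt_top _ (lt_top_iff_ne_top.2 hne)
  obtain ⟨u, rfl⟩ := (S.dualEquiv c).surjective f
  have key : ∀ φ : starObj c ⟶ starObj (𝟙_ C), S.toReal (S.map φ u) = 0 := by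
    intro φ
    have := StarAutonomous.full (C := C)
    obtain ⟨φ', rfl⟩ := StarAutonomous.star.map_surjective φ
    have h1 : S.toReal (S.map (starMap φ'.unop) u) = S.dualEquiv c u (S.map φ'.unop S.one) :=
      S.dualEquiv_naturality φ'.unop u S.one
    refine h1.trans (hf (Submodule.subset_span ⟨_, rfl⟩))
  have hu : u = 0 := h u (fun φ => (key φ).ge) fun φ => by rw [map_neg, map_neg, key, neg_zero]
  exact hf0 (by rw [hu, map_zero])

end Stem

namespace Stem

variable (S)

lemma form_comp {a b c : C} (θ : a ⟶ b) (χ : b ⟶ starObj c) :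
    (S.form χ).compl₁₂ (S.map θ) LinearMap.id = S.form (θ ≫ χ) := by
  ext s t
  simp [form_apply, map_comp_apply]

lemma form_eq_id_comp {a b : C} (χ : a ⟶ starObj b) :
    S.form χ = (S.form (𝟙 (starObj b))).compl₁₂ (S.map χ) LinearMap.id := by
  rw [form_comp, Category.comp_id]

lemma pairing_eq_tensorPairing (X : Type) [AddCommGroup X] [Module ℝ X] (c : C) :
    S.pairing X c = tensorPairing (Module.Dual.eval ℝ X) (S.form (𝟙 (starObj c))) := by
  ext
  simp [form_apply, map_id_apply]

lemma mul_mem_intrinsicCone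
    (hmul : ∀ c d : C,
      ((S.intrinsicCone c).minTensorProduct (S.intrinsicCone d)).map (S.mul c d).toLinearMap ≤
        S.intrinsicCone (c ⊗ d)) {c d : C} {x : S.obj c} {y : S.obj d}
    (hx : x ∈ S.intrinsicCone c) (hy : y ∈ S.intrinsicCone d) :
    S.mul c d (x ⊗ₜ[ℝ] y) ∈ S.intrinsicCone (c ⊗ d) :=
  hmul c d ⟨_, PointedCone.tmul_mem_minTensorProduct hx hy, rfl⟩

lemma toReal_map_mul_contract {X Y : Type} [AddCommGroup X] [Module ℝ X] [AddCommGroup Y]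
    [Module ℝ Y] (α : X →ₗ[ℝ] Y →ₗ[ℝ] ℝ) {a b : C} {χ : a ⟶ starObj b}
    {θ : a ⊗ b ⟶ starObj (𝟙_ C)}
    (h : ∀ s t, S.form χ s t = S.toReal (S.map θ (S.mul a b (s ⊗ₜ[ℝ] t))))
    (z : X ⊗[ℝ] S.obj a) (w : Y ⊗[ℝ] S.obj b) :
    S.toReal (S.map θ (S.mul a b (contract α z w))) = tensorPairing α (S.form χ) z w := by
  have : (contract α).compr₂ (S.toReal ∘ₗ S.map θ ∘ₗ (S.mul a b).toLinearMap) =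
      tensorPairing α (S.form χ) := by
    ext
    simp [h]
  rw [← this]
  rfl

end Stem

/-! ### Positive pairings of systems. -/

namespace System

variable {X Y X' Y' : Type} [AddCommGroup X] [Module ℝ X] [AddCommGroup Y] [Module ℝ Y]
  [AddCommGroup X'] [Module ℝ X'] [AddCommGroup Y'] [Module ℝ Y']

lemma ext_cone {G H : System S X} (h : ∀ c, G.cone c = H.cone c) : G = H := by
  cases G
  cases H
  congr
  exact funext h

/-- A bilinear pairing of the underlying spaces is positive on two systems if, together with any
morphism `c ⟶ d^*`, it is nonnegative on the cones at the levels `c` and `d`. -/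
def PositivePairing (G : System S X) (H : System S Y) (α : X →ₗ[ℝ] Y →ₗ[ℝ] ℝ) : Prop :=
  ∀ (c d : C) (χ : c ⟶ starObj d), ∀ z ∈ G.cone c, ∀ w ∈ H.cone d,
    0 ≤ tensorPairing α (S.form χ) z w

lemma PositivePairing.flip {G : System S X} {H : System S Y} {α : X →ₗ[ℝ] Y →ₗ[ℝ] ℝ}
    (h : PositivePairing G H α) : PositivePairing H G α.flip := by
  intro c d χ z hz w hw
  obtain ⟨χ', hχ⟩ := S.exists_form_flip χ
  have := h d c χ' w hw z hz
  rwa [hχ, ← tensorPairing_flip] at this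

lemma PositivePairing.comp {G : System S X} {G' : System S X'} {H : System S Y}
    {α : X' →ₗ[ℝ] Y →ₗ[ℝ] ℝ} (h : PositivePairing G' H α) {φ : X →ₗ[ℝ] X'}
    (hφ : CompletelyPositive G G' φ) : PositivePairing G H (α.compl₁₂ φ LinearMap.id) := by
  intro c d χ z hz w hw
  have h1 := h c d χ _ (hφ c z hz) w hw
  have h2 := tensorPairing_map α (S.form χ) φ LinearMap.id LinearMap.id LinearMap.id z w
  rw [TensorProduct.map_id] at h2
  exact h1.trans_eq h2

/-- A morphism `χ : c ⟶ d^*` carries `G(c)` into `G(d^*)`, where the definition of the dual cone at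
level `d` applies. -/
lemma positivePairing_dual (G : System S X) :
    PositivePairing G.dual G (LinearMap.id : Module.Dual ℝ X →ₗ[ℝ] Module.Dual ℝ X) := by
  refine PositivePairing.flip (α := Module.Dual.eval ℝ X) fun c d χ z hz w hw => ?_
  have h1 : 0 ≤ S.pairing X d ((S.map χ).lTensor X z) w := hw (G.map_mem χ hz)
  rw [S.pairing_eq_tensorPairing] at h1
  rw [S.form_eq_id_comp]
  have h2 := tensorPairing_map (Module.Dual.eval ℝ X) (S.form (𝟙 (starObj d))) LinearMap.id
    (S.map χ) LinearMap.id LinearMap.id z w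
  rw [TensorProduct.map_id] at h2
  exact h1.trans_eq h2

/-- The dual cone at level `c` is tested with `H(c^*)` alone, so the flipped pairing at the identity
of `c^*` suffices. -/
lemma PositivePairing.completelyPositive {G : System S X} {H : System S Y}
    {α : X →ₗ[ℝ] Y →ₗ[ℝ] ℝ} (h : PositivePairing G H α) : CompletelyPositive G H.dual α := by
  intro c z hz w hw
  have h1 := h.flip _ _ (𝟙 (starObj c)) w hw z hz
  rw [S.pairing_eq_tensorPairing]
  have h2 := tensorPairing_map (Module.Dual.eval ℝ Y) (S.form (𝟙 (starObj c))) LinearMap.id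
    LinearMap.id α LinearMap.id w z
  rw [TensorProduct.map_id] at h2
  exact h1.trans_eq h2.symm

/-- Tests `c ⊗ d ⟶ 𝟙^*` of the contraction are, by currying, exactly morphisms `c ⟶ d^*`, over which
positivity of `α` ranges. -/
lemma contract_mem_intrinsicCone {G : System S X} {H : System S Y} {α : X →ₗ[ℝ] Y →ₗ[ℝ] ℝ}
    (h : PositivePairing G H α) {c d : C} {z : X ⊗[ℝ] S.obj c} (hz : z ∈ G.cone c)
    {w : Y ⊗[ℝ] S.obj d} (hw : w ∈ H.cone d) :
    S.mul c d (contract α z w) ∈ S.intrinsicCone (c ⊗ d) := by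
  intro θ
  obtain ⟨χ, hχ⟩ := S.exists_curry θ
  rw [S.toReal_map_mul_contract α hχ]
  exact h c d χ z hz w hw

/-- Regrouping with `tensorμ` brings `c` next to `c'` and `d` next to `d'`, which turns the pairing
of two products into a test of a product of two contractions. By multilinearity it is enough to
compute on pure tensors. -/
lemma tensorPairing_mulTensor (α : X →ₗ[ℝ] X' →ₗ[ℝ] ℝ) (β : Y →ₗ[ℝ] Y' →ₗ[ℝ] ℝ) {c d c' d' : C}
    {χ : c ⊗ d ⟶ starObj (c' ⊗ d')} {θ : (c ⊗ d) ⊗ (c' ⊗ d') ⟶ starObj (𝟙_ C)}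
    (h : ∀ s t, S.form χ s t = S.toReal (S.map θ (S.mul _ _ (s ⊗ₜ[ℝ] t))))
    (x : X ⊗[ℝ] S.obj c) (y : Y ⊗[ℝ] S.obj d) (x' : X' ⊗[ℝ] S.obj c') (y' : Y' ⊗[ℝ] S.obj d') :
    tensorPairing (tensorPairing α β) (S.form χ) (S.mulTensor X Y c d (x ⊗ₜ y))
        (S.mulTensor X' Y' c' d' (x' ⊗ₜ y')) =
      S.toReal (S.map (tensorμ c c' d d' ≫ θ) (S.mul _ _
        (S.mul c c' (contract α x x') ⊗ₜ[ℝ] S.mul d d' (contract β y y')))) := by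
  induction x with
  | zero => simp
  | add a b ha hb => simp only [map_add, TensorProduct.add_tmul, LinearMap.add_apply, ha, hb]
  | tmul x s =>
  induction y with
  | zero => simp
  | add a b ha hb =>
    simp only [map_add, TensorProduct.tmul_add, LinearMap.add_apply, ha, hb]
  | tmul y r =>
  induction x' with
  | zero => simp
  | add a b ha hb =>
    simp only [map_add, TensorProduct.add_tmul, ha, hb]
  | tmul x' s' =>
  induction y' with
  | zero => simp
  | add a b ha hb => simp only [map_add, TensorProduct.tmul_add, ha, hb]
  | tmul y' r' =>
  simp only [Stem.mulTensor, LinearMap.comp_apply, LinearEquiv.coe_coe,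
    TensorProduct.tensorTensorTensorComm_tmul, LinearMap.lTensor_tmul, tensorPairing_tmul, h,
    contract_tmul, map_smul, ← TensorProduct.smul_tmul', TensorProduct.tmul_smul, smul_eq_mul,
    Stem.map_comp_apply, Stem.map_tensorμ]
  ring

lemma tensorPairing_mulTensor_nonneg
    (hmul : ∀ c d : C,
      ((S.intrinsicCone c).minTensorProduct (S.intrinsicCone d)).map (S.mul c d).toLinearMap ≤
        S.intrinsicCone (c ⊗ d))
    {G : System S X} {G' : System S X'} {H : System S Y} {H' : System S Y'}
    {α : X →ₗ[ℝ] X' →ₗ[ℝ] ℝ} {β : Y →ₗ[ℝ] Y' →ₗ[ℝ] ℝ} (hα : PositivePairing G G' α)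
    (hβ : PositivePairing H H' β) {c d c' d' : C} (χ : c ⊗ d ⟶ starObj (c' ⊗ d'))
    {x : X ⊗[ℝ] S.obj c} (hx : x ∈ G.cone c) {y : Y ⊗[ℝ] S.obj d} (hy : y ∈ H.cone d)
    {x' : X' ⊗[ℝ] S.obj c'} (hx' : x' ∈ G'.cone c') {y' : Y' ⊗[ℝ] S.obj d'}
    (hy' : y' ∈ H'.cone d') :
    0 ≤ tensorPairing (tensorPairing α β) (S.form χ) (S.mulTensor X Y c d (x ⊗ₜ y))
        (S.mulTensor X' Y' c' d' (x' ⊗ₜ y')) := by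
  obtain ⟨θ, hθ⟩ := S.exists_uncurry χ
  rw [tensorPairing_mulTensor α β hθ]
  exact S.mul_mem_intrinsicCone hmul (contract_mem_intrinsicCone hα hx hx')
    (contract_mem_intrinsicCone hβ hy hy') _

/-- All cones of a proper system are generating. -/
lemma Proper.span_cone_eq_top [Module.Finite ℝ X] {G : System S X} (hG : G.Proper)
    (hsharp : ∀ c : C, SharpCone (S.intrinsicCone c)) (c : C) :
    Submodule.span ℝ (G.cone c : Set (X ⊗[ℝ] S.obj c)) = ⊤ := by
  have h1 := (fullCone_iff_span _).1 hG.full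
  -- The cone at level `𝟙` already spans. Pushing it along the points `φ` of `c` reaches all `x ⊗ S
  -- φ 1`, and the vectors `S φ 1` span `S c`.
  have h2 : ∀ (φ : 𝟙_ C ⟶ c) (z : X ⊗[ℝ] S.obj (𝟙_ C)), (S.map φ).lTensor X z ∈
      Submodule.span ℝ (G.cone c : Set (X ⊗[ℝ] S.obj c)) := by
    intro φ z
    have hz : z ∈ Submodule.span ℝ (G.cone (𝟙_ C) : Set (X ⊗[ℝ] S.obj (𝟙_ C))) := h1 ▸ trivial
    induction hz using Submodule.span_induction with
    | mem z hz => exact Submodule.subset_span (G.map_mem φ hz)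
    | zero => simp
    | add a b _ _ ha hb => rw [map_add]; exact add_mem ha hb
    | smul r a _ ha => rw [map_smul]; exact Submodule.smul_mem _ r ha
  rw [eq_top_iff]
  rintro z -
  induction z with
  | zero => exact zero_mem _
  | add a b ha hb => exact add_mem ha hb
  | tmul x s =>
    have hs : s ∈ Submodule.span ℝ (Set.range fun φ : 𝟙_ C ⟶ c => S.map φ S.one) :=
      S.span_range_map_one c (hsharp _) ▸ trivial
    induction hs using Submodule.span_induction with
    | mem s hs =>
      obtain ⟨φ, rfl⟩ := hs
      exact h2 φ (x ⊗ₜ S.one)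
    | zero => simp
    | add a b _ _ ha hb => rw [TensorProduct.tmul_add]; exact add_mem ha hb
    | smul r a _ ha => rw [TensorProduct.tmul_smul]; exact Submodule.smul_mem _ r ha

end System

/-! ### Differences of elements of a generating cone. -/

section Cones

variable {V : Type} [AddCommGroup V] [Module ℝ V]

lemma exists_sub_of_span_eq_top {K : PointedCone ℝ V}
    (hK : Submodule.span ℝ (K : Set V) = ⊤) (z : V) : ∃ p ∈ K, ∃ t ∈ K, z = p - t := by
  have hz : z ∈ Submodule.span ℝ (K : Set V) := hK ▸ trivial
  have hsmul : ∀ r : ℝ, 0 ≤ r → ∀ p ∈ K, r • p ∈ K := fun r hr p hp =>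
    K.smul_mem hr hp
  induction hz using Submodule.span_induction with
  | mem z hz => exact ⟨z, hz, 0, zero_mem K, by simp⟩
  | zero => exact ⟨0, zero_mem K, 0, zero_mem K, by simp⟩
  | add a b _ _ ha hb =>
    obtain ⟨p, hp, t, ht, rfl⟩ := ha
    obtain ⟨p', hp', t', ht', rfl⟩ := hb
    exact ⟨p + p', add_mem hp hp', t + t', add_mem ht ht', by abel⟩
  | smul r a _ ha =>
    obtain ⟨p, hp, t, ht, rfl⟩ := ha
    rcases le_total 0 r with hr | hr
    · exact ⟨r • p, hsmul r hr p hp, r • t, hsmul r hr t ht, smul_sub _ _ _⟩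
    · refine ⟨(-r) • t, hsmul _ (neg_nonneg.2 hr) t ht, (-r) • p,
        hsmul _ (neg_nonneg.2 hr) p hp, ?_⟩
      simp only [smul_sub, neg_smul]
      abel

end Cones

/-! ### The identification of `X ⊗ Y` with `(X' ⊗ Y')'` at the level of systems. -/

section TensorBidual

variable {X Y : Type} [AddCommGroup X] [Module ℝ X] [AddCommGroup Y] [Module ℝ Y]

lemma tensorBidual_injective (X Y : Type) [AddCommGroup X] [Module ℝ X]
    [AddCommGroup Y] [Module ℝ Y] [Module.Finite ℝ X] [Module.Finite ℝ Y] :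
    Function.Injective (tensorBidual X Y) := by
  have h : tensorBidual X Y = ((TensorProduct.congr (Module.evalEquiv ℝ X)
      (Module.evalEquiv ℝ Y)).trans (TensorProduct.dualDistribEquiv ℝ (Module.Dual ℝ X)
        (Module.Dual ℝ Y))).toLinearMap := by
    ext
    simp [tensorBidual]
  rw [h]
  exact LinearEquiv.injective _

lemma pairing_tensorBidual (c : C)
    (w : (Module.Dual ℝ X ⊗[ℝ] Module.Dual ℝ Y) ⊗[ℝ] S.obj (starObj c))
    (z : (X ⊗[ℝ] Y) ⊗[ℝ] S.obj c) :
    S.pairing (Module.Dual ℝ X ⊗[ℝ] Module.Dual ℝ Y) c w ((tensorBidual X Y).rTensor _ z) =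
      tensorPairing (tensorPairing (LinearMap.id : Module.Dual ℝ X →ₗ[ℝ] Module.Dual ℝ X)
        (LinearMap.id : Module.Dual ℝ Y →ₗ[ℝ] Module.Dual ℝ Y)) (S.form (𝟙 (starObj c))) w z := by
  have h : (S.pairing (Module.Dual ℝ X ⊗[ℝ] Module.Dual ℝ Y) c).compl₂
      ((tensorBidual X Y).rTensor _) =
      tensorPairing (tensorPairing (LinearMap.id : Module.Dual ℝ X →ₗ[ℝ] Module.Dual ℝ X)
        (LinearMap.id : Module.Dual ℝ Y →ₗ[ℝ] Module.Dual ℝ Y)) (S.form (𝟙 (starObj c))) := by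
    ext
    simp [tensorBidual, Stem.form_apply, Stem.map_id_apply]
  rw [← h, LinearMap.compl₂_apply]

lemma System.mem_comap_tensorBidual_dual {K : System S (Module.Dual ℝ X ⊗[ℝ] Module.Dual ℝ Y)}
    {c : C} {z : (X ⊗[ℝ] Y) ⊗[ℝ] S.obj c} :
    z ∈ (K.dual.comap (tensorBidual X Y)).cone c ↔ ∀ w ∈ K.cone (starObj c),
      0 ≤ tensorPairing (tensorPairing (LinearMap.id : Module.Dual ℝ X →ₗ[ℝ] Module.Dual ℝ X)
        (LinearMap.id : Module.Dual ℝ Y →ₗ[ℝ] Module.Dual ℝ Y)) (S.form (𝟙 (starObj c))) w z := by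
  have h : z ∈ (K.dual.comap (tensorBidual X Y)).cone c ↔ ∀ w ∈ K.cone (starObj c), 0 ≤
    S.pairing (Module.Dual ℝ X ⊗[ℝ] Module.Dual ℝ Y) c w ((tensorBidual X Y).rTensor _ z) := Iff.rfl
  simp only [h, pairing_tensorBidual]

lemma System.sharpCone_comap_dual {Z : Type} [AddCommGroup Z] [Module ℝ Z] [Module.Finite ℝ Z]
    {K : System S Z} {f : X →ₗ[ℝ] Module.Dual ℝ Z} (hf : Function.Injective f) {c : C}
    (hK : FullCone (K.cone (starObj c))) : SharpCone ((K.dual.comap f).cone c) := by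
  intro z hz hz'
  have hz1 : f.rTensor (S.obj c) (-z) ∈ K.dual.cone c := hz'
  rw [map_neg] at hz1
  have h0 := sharpCone_dual _ (S.bijective_pairing _ c).2 hK (f.rTensor (S.obj c) z) hz hz1
  exact Module.Flat.rTensor_preserves_injective_linearMap (M := S.obj c) _ hf
    (h0.trans (map_zero _).symm)

end TensorBidual

/-! ### Compatibility of elements and polar systems. -/

variable (S) in
/-- An element of some space `(X ⊗ Y) ⊗ S c`, where `X` and `Y` underlie proper systems. -/
structure TensorElement where
  fst : ProperSystem S
  snd : ProperSystem S
  level : C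
  vec : (fst.space ⊗[ℝ] snd.space) ⊗[ℝ] S.obj level

namespace TensorElement

/-- Two elements are compatible if all pairings of them which are induced by positive pairings of
the systems and by a morphism of `C` are nonnegative. -/
def Compat (e e' : TensorElement S) : Prop :=
  ∀ α : e.fst.space →ₗ[ℝ] e'.fst.space →ₗ[ℝ] ℝ, e.fst.system.PositivePairing e'.fst.system α →
  ∀ β : e.snd.space →ₗ[ℝ] e'.snd.space →ₗ[ℝ] ℝ, e.snd.system.PositivePairing e'.snd.system β →
  ∀ χ : e.level ⟶ starObj e'.level,
    0 ≤ tensorPairing (tensorPairing α β) (S.form χ) e.vec e'.vec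

lemma tensorPairing_flip_flip {X Y X' Y' : Type} [AddCommGroup X] [Module ℝ X] [AddCommGroup Y]
    [Module ℝ Y] [AddCommGroup X'] [Module ℝ X'] [AddCommGroup Y'] [Module ℝ Y']
    (α : X →ₗ[ℝ] X' →ₗ[ℝ] ℝ) (β : Y →ₗ[ℝ] Y' →ₗ[ℝ] ℝ) :
    tensorPairing α.flip β.flip = (tensorPairing α β).flip := by
  ext
  simp

lemma Compat.symm {e e' : TensorElement S} (h : Compat e e') : Compat e' e := by
  intro α hα β hβ χ
  obtain ⟨χ', hχ⟩ := S.exists_form_flip χ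
  have := h _ hα.flip _ hβ.flip χ'
  rwa [hχ, tensorPairing_flip_flip, tensorPairing_flip] at this

/-- Every pairing testing the image is itself a pairing testing `z`: positive pairings pull back
along `φ` and `ψ`, and `χ` is precomposed with `θ`. Functoriality of the tensor product rests on
this. -/
lemma Compat.map_left {G H : ProperSystem S} {c : C}
    {z : (G.space ⊗[ℝ] H.space) ⊗[ℝ] S.obj c} {e : TensorElement S} (h : Compat ⟨G, H, c, z⟩ e)
    {G' H' : ProperSystem S} {c' : C} (φ : G ⟶ G') (ψ : H ⟶ H') (θ : c ⟶ c') :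
    Compat ⟨G', H', c', TensorProduct.map (TensorProduct.map φ.linear ψ.linear) (S.map θ) z⟩ e := by
  intro α hα β hβ χ
  have h1 := h _ (hα.comp φ.cp) _ (hβ.comp ψ.cp) (θ ≫ χ)
  have h2 := tensorPairing_map (tensorPairing α β) (S.form χ)
    (TensorProduct.map φ.linear ψ.linear) (S.map θ) LinearMap.id LinearMap.id z e.vec
  rw [TensorProduct.map_id] at h2
  refine h1.trans_eq (Eq.trans ?_ h2.symm)
  rw [S.form_comp]
  congr 3
  ext
  simp

/-- The cone of all elements at level `c` that are compatible with all elements of a set. -/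
def polarCone (P : Set (TensorElement S)) (G H : ProperSystem S) (c : C) :
    PointedCone ℝ ((G.space ⊗[ℝ] H.space) ⊗[ℝ] S.obj c) where
  carrier := {z | ∀ e ∈ P, Compat e ⟨G, H, c, z⟩}
  add_mem' {x y} hx hy e he α hα β hβ χ := by
    have h := (tensorPairing (tensorPairing α β) (S.form χ) e.vec).map_add x y
    exact (add_nonneg (hx e he α hα β hβ χ) (hy e he α hα β hβ χ)).trans_eq h.symm
  zero_mem' e he α hα β hβ χ :=
    (tensorPairing (tensorPairing α β) (S.form χ) e.vec).map_zero.ge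
  smul_mem' r x hx e he α hα β hβ χ := by
    have h := (tensorPairing (tensorPairing α β) (S.form χ) e.vec).map_smul (r : ℝ) x
    exact (mul_nonneg r.2 (hx e he α hα β hβ χ)).trans_eq h.symm

/-- Writing the cone as an intersection of dual cones makes its closedness immediate. -/
lemma polarCone_eq_sInf (P : Set (TensorElement S)) (G H : ProperSystem S) (c : C) :
    polarCone P G H c = sInf {L | ∃ e ∈ P,
      ∃ α : e.fst.space →ₗ[ℝ] G.space →ₗ[ℝ] ℝ, e.fst.system.PositivePairing G.system α ∧
      ∃ β : e.snd.space →ₗ[ℝ] H.space →ₗ[ℝ] ℝ, e.snd.system.PositivePairing H.system β ∧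
      ∃ χ : e.level ⟶ starObj c,
        L = PointedCone.dual (tensorPairing (tensorPairing α β) (S.form χ)) {e.vec}} := by
  refine SetLike.ext fun z => ?_
  rw [Submodule.mem_sInf]
  constructor
  · rintro h _ ⟨e, he, α, hα, β, hβ, χ, rfl⟩ _ rfl
    exact h e he α hα β hβ χ
  · intro h e he α hα β hβ χ
    exact h _ ⟨e, he, α, hα, β, hβ, χ, rfl⟩ rfl

lemma Compat.lTensor_left {G H : ProperSystem S} {c : C}
    {z : (G.space ⊗[ℝ] H.space) ⊗[ℝ] S.obj c} {e : TensorElement S} (h : Compat ⟨G, H, c, z⟩ e)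
    {d : C} (θ : c ⟶ d) : Compat ⟨G, H, d, (S.map θ).lTensor _ z⟩ e := by
  have h := h.map_left (𝟙 G) (𝟙 H) θ
  have h1 : TensorProduct.map (ProperSystem.Hom.linear (𝟙 G)) (ProperSystem.Hom.linear (𝟙 H)) =
    LinearMap.id := TensorProduct.map_id
  rw [h1] at h
  exact h

/-- The elements that are compatible with all elements of a set form a system. -/
def polar (P : Set (TensorElement S)) (G H : ProperSystem S) :
    System S (G.space ⊗[ℝ] H.space) where
  cone c := polarCone P G H c
  closed c := by
    rw [polarCone_eq_sInf]
    refine closedCone_sInf _ ?_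
    rintro _ ⟨e, he, α, hα, β, hβ, χ, rfl⟩
    exact closedCone_dual _ _
  map_mem φ _ hz e he := ((hz e he).symm.lTensor_left φ).symm

lemma mem_polar {P : Set (TensorElement S)} {G H : ProperSystem S} {c : C}
    {z : (G.space ⊗[ℝ] H.space) ⊗[ℝ] S.obj c} :
    z ∈ (polar P G H).cone c ↔ ∀ e ∈ P, Compat e ⟨G, H, c, z⟩ := Iff.rfl

lemma map_mem_polar {P : Set (TensorElement S)} {G H G' H' : ProperSystem S} {c c' : C}
    {z : (G.space ⊗[ℝ] H.space) ⊗[ℝ] S.obj c} (hz : z ∈ (polar P G H).cone c)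
    (φ : G ⟶ G') (ψ : H ⟶ H') (θ : c ⟶ c') :
    TensorProduct.map (TensorProduct.map φ.linear ψ.linear) (S.map θ) z ∈
      (polar P G' H').cone c' :=
  fun e he => ((hz e he).symm.map_left φ ψ θ).symm

/-! ### Maximal cliques. -/

/-- A set of elements which are pairwise compatible and compatible with themselves. -/
def IsClique (P : Set (TensorElement S)) : Prop := ∀ e ∈ P, ∀ e' ∈ P, Compat e e'

lemma exists_maximal_clique {P : Set (TensorElement S)} (hP : IsClique P) :
    ∃ Q, P ⊆ Q ∧ Maximal IsClique Q := by
  refine zorn_subset_nonempty {Q : Set (TensorElement S) | IsClique Q} ?_ P hP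
  intro c hc hchain _
  refine ⟨⋃₀ c, ?_, fun s hs => Set.subset_sUnion_of_mem hs⟩
  rintro e ⟨s, hs, hes⟩ e' ⟨s', hs', hes'⟩
  rcases hchain.total hs hs' with h | h
  · exact hc hs' e (h hes) e' hes'
  · exact hc hs e hes e' (h hes')

section Maximal

variable {P : Set (TensorElement S)}

/-- Under these assumptions `insert e P` is again a clique. Self-compatibility of `e` is the only
condition beyond lying in the polar. -/
lemma mem_of_maximal (hP : Maximal IsClique P) {e : TensorElement S}
    (h : ∀ e' ∈ P, Compat e' e) (he : Compat e e) :
    e ∈ P := by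
  refine hP.2 (y := insert e P) ?_ (Set.subset_insert e P) (Set.mem_insert e P)
  rintro a (rfl | ha) b (rfl | hb)
  · exact he
  · exact (h b hb).symm
  · exact h a ha
  · exact hP.1 a ha b hb

lemma mem_polar_of_mem (hP : Maximal IsClique P) {G H : ProperSystem S} {c : C}
    {z : (G.space ⊗[ℝ] H.space) ⊗[ℝ] S.obj c} (hz : ⟨G, H, c, z⟩ ∈ P) :
    z ∈ (polar P G H).cone c := fun e he => hP.1 e he _ hz

/-- The elements at level `c` which belong to a maximal clique form a cone. -/
def maximalCone (hP : Maximal IsClique P) (G H : ProperSystem S) (c : C) :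
    PointedCone ℝ ((G.space ⊗[ℝ] H.space) ⊗[ℝ] S.obj c) where
  carrier := {z | ⟨G, H, c, z⟩ ∈ P}
  add_mem' {x y} hx hy := by
    refine mem_of_maximal hP (mem_polar.1 (add_mem (mem_polar_of_mem hP hx)
      (mem_polar_of_mem hP hy))) fun α hα β hβ χ => ?_
    -- Self-compatibility of `x + y` is the sum of four pairings between members of the clique.
    have h1 := hP.1 _ hx _ hx α hα β hβ χ
    have h2 := hP.1 _ hx _ hy α hα β hβ χ
    have h3 := hP.1 _ hy _ hx α hα β hβ χ
    have h4 := hP.1 _ hy _ hy α hα β hβ χ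
    simp only [map_add, LinearMap.add_apply]
    dsimp only at h1 h2 h3 h4 ⊢
    linarith
  zero_mem' := by
    refine mem_of_maximal hP (mem_polar.1 (zero_mem ((polar P G H).cone c))) fun α hα β hβ χ => ?_
    rw [map_zero]
  smul_mem' r x hx := by
    refine mem_of_maximal hP (mem_polar.1 (Submodule.smul_mem _ r (mem_polar_of_mem hP hx)))
      fun α hα β hβ χ => ?_
    have h1 := hP.1 _ hx _ hx α hα β hβ χ
    change 0 ≤ tensorPairing (tensorPairing α β) (S.form χ) ((r : ℝ) • x) ((r : ℝ) • x)
    rw [map_smul, map_smul, LinearMap.smul_apply]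
    exact mul_nonneg r.2 (mul_nonneg r.2 h1)

/-- A maximal clique whose cones are generating contains all elements compatible with it. -/
lemma mem_of_mem_polar (hP : Maximal IsClique P) {G H : ProperSystem S} {c : C}
    (hspan : Submodule.span ℝ (maximalCone hP G H c :
      Set ((G.space ⊗[ℝ] H.space) ⊗[ℝ] S.obj c)) = ⊤)
    {z : (G.space ⊗[ℝ] H.space) ⊗[ℝ] S.obj c} (hz : z ∈ (polar P G H).cone c) :
    ⟨G, H, c, z⟩ ∈ P := by
  -- Now `z + t = p` is in the clique. The multiple of `t` will be shrunk to zero while staying in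
  -- the clique.
  obtain ⟨p, hp, t, ht, rfl⟩ := exists_sub_of_span_eq_top hspan z
  set z := p - t with hzdef
  have hpz : p = z + (1 : ℝ) • t := by rw [hzdef, one_smul, sub_add_cancel]
  have half : ∀ r : ℝ, 0 ≤ r → (⟨G, H, c, z + r • t⟩ : TensorElement S) ∈ P →
      (⟨G, H, c, z + (r / 2) • t⟩ : TensorElement S) ∈ P := by
    intro r hr h
    have hrt : (r / 2) • t ∈ (polar P G H).cone c :=
      Submodule.smul_mem _ (⟨r / 2, by positivity⟩ : {c : ℝ // 0 ≤ c}) (mem_polar_of_mem hP ht)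
    refine mem_of_maximal hP (mem_polar.1 (add_mem hz hrt)) fun α hα β hβ χ => ?_
    -- For the pairing `B` given by `α`, `β`, `χ`, compatibility of `z` with `z + r t` in both
    -- orders gives `B(z,z) + r B(t,z) ≥ 0` and `B(z,z) + r B(z,t) ≥ 0`. Their average plus `(r²/4)
    -- B(t,t) ≥ 0` is `B(z + (r/2) t, z + (r/2) t)`.
    have h1 := hz _ h α hα β hβ χ
    have h2 := (hz _ h).symm α hα β hβ χ
    have h3 := hP.1 _ ht _ ht α hα β hβ χ
    simp only [map_add, map_smul, LinearMap.add_apply, LinearMap.smul_apply, smul_eq_mul]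
      at h1 h2 ⊢
    have h4 := mul_nonneg (mul_nonneg hr hr) h3
    dsimp only at h1 h2 h3 h4 ⊢
    linarith
  have hpow : ∀ n : ℕ, (⟨G, H, c, z + ((1 / 2 : ℝ) ^ n) • t⟩ : TensorElement S) ∈ P := by
    intro n
    induction n with
    | zero => rw [pow_zero, ← hpz]; exact hp
    | succ n ih =>
      have := half _ (by positivity) ih
      rwa [pow_succ, mul_one_div]
  refine mem_of_maximal hP (mem_polar.1 hz) fun α hα β hβ χ => ?_
  -- Pairing `z + 2⁻ⁿ t`, now in the clique, with `z` in the polar gives nonnegative numbers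
  -- converging to `B(z,z)`, so `z` is self-compatible.
  have hlim : Filter.Tendsto (fun n : ℕ =>
      tensorPairing (tensorPairing α β) (S.form χ) z z +
        (1 / 2 : ℝ) ^ n * tensorPairing (tensorPairing α β) (S.form χ) t z) Filter.atTop
      (nhds (tensorPairing (tensorPairing α β) (S.form χ) z z + 0 *
        tensorPairing (tensorPairing α β) (S.form χ) t z)) :=
    tendsto_const_nhds.add ((tendsto_pow_atTop_nhds_zero_of_lt_one (by norm_num)
      (by norm_num)).mul_const _)
  rw [zero_mul, add_zero] at hlim
  refine ge_of_tendsto' hlim fun n => ?_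
  have h1 := hz _ (hpow n) α hα β hβ χ
  simpa only [map_add, map_smul, LinearMap.add_apply, LinearMap.smul_apply, smul_eq_mul] using h1

end Maximal

/-! ### The clique of products and self-duality of the polar. -/

variable (S) in
/-- The images of all products of elements of two proper systems. -/
def products : Set (TensorElement S) :=
  {e | ∃ (G H : ProperSystem S) (a c d : C) (θ : c ⊗ d ⟶ a),
    ∃ x ∈ G.system.cone c, ∃ y ∈ H.system.cone d,
    e = ⟨G, H, a, (S.map θ).lTensor _ (S.mulTensor G.space H.space c d (x ⊗ₜ y))⟩}

lemma isClique_products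
    (hmul : ∀ c d : C,
      ((S.intrinsicCone c).minTensorProduct (S.intrinsicCone d)).map (S.mul c d).toLinearMap ≤
        S.intrinsicCone (c ⊗ d)) : IsClique (products S) := by
  rintro _ ⟨G, H, a, c, d, θ, x, hx, y, hy, rfl⟩ _ ⟨G', H', a', c', d', θ', x', hx', y', hy', rfl⟩
  -- Compatibility passes along `θ` and `θ'`, so only the products themselves have to be compared.
  refine Compat.lTensor_left (Compat.symm (Compat.lTensor_left (Compat.symm ?_) θ')) θ
  intro α hα β hβ χ
  exact System.tensorPairing_mulTensor_nonneg hmul hα hβ χ hx hy hx' hy'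

lemma span_products_eq_top (hsharp : ∀ c : C, SharpCone (S.intrinsicCone c))
    (G H : ProperSystem S) (a : C) :
    Submodule.span ℝ {z | (⟨G, H, a, z⟩ : TensorElement S) ∈ products S} = ⊤ := by
  -- Products of levels `𝟙` and `a`, moved to level `a` by the left unitor, suffice: `x ⊗ 1` times
  -- `y ⊗ s` becomes `(x ⊗ y) ⊗ s`.
  have key : ∀ (x : G.space ⊗[ℝ] S.obj (𝟙_ C)) (y : H.space ⊗[ℝ] S.obj a),
      (S.map (λ_ a).hom).lTensor _ (S.mulTensor G.space H.space (𝟙_ C) a (x ⊗ₜ y)) ∈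
        Submodule.span ℝ {z | (⟨G, H, a, z⟩ : TensorElement S) ∈ products S} := by
    intro x y
    have hx : x ∈ Submodule.span ℝ (G.system.cone (𝟙_ C) : Set _) :=
      G.proper.span_cone_eq_top hsharp _ ▸ trivial
    have hy : y ∈ Submodule.span ℝ (H.system.cone a : Set _) :=
      H.proper.span_cone_eq_top hsharp _ ▸ trivial
    induction hx using Submodule.span_induction with
    | mem x hx =>
      induction hy using Submodule.span_induction with
      | mem y hy => exact Submodule.subset_span ⟨_, _, _, _, _, _, x, hx, y, hy, rfl⟩
      | zero => simp
      | add y y' _ _ h h' => rw [TensorProduct.tmul_add, map_add, map_add]; exact add_mem h h'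
      | smul r y _ h =>
        rw [TensorProduct.tmul_smul, map_smul, map_smul]; exact Submodule.smul_mem _ r h
    | zero => simp
    | add x x' _ _ h h' => rw [TensorProduct.add_tmul, map_add, map_add]; exact add_mem h h'
    | smul r x _ h =>
      rw [← TensorProduct.smul_tmul', map_smul, map_smul]; exact Submodule.smul_mem _ r h
  rw [eq_top_iff]
  rintro z -
  induction z with
  | zero => exact zero_mem _
  | add z z' h h' => exact add_mem h h'
  | tmul w s =>
    induction w with
    | zero => simp
    | add w w' h h' => rw [TensorProduct.add_tmul]; exact add_mem h h'
    | tmul x y =>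
      have h := key (x ⊗ₜ S.one) (y ⊗ₜ s)
      simpa only [Stem.mulTensor, LinearMap.comp_apply, LinearEquiv.coe_coe,
        TensorProduct.tensorTensorTensorComm_tmul, LinearMap.lTensor_tmul, S.mul_one_left] using h

/-- The system of elements compatible with a maximal clique is self-dual. -/
lemma polar_eq_dual {P : Set (TensorElement S)} (hP : Maximal IsClique P)
    (hspan : ∀ G H c, Submodule.span ℝ (maximalCone hP G H c :
      Set ((G.space ⊗[ℝ] H.space) ⊗[ℝ] S.obj c)) = ⊤)
    (G H : ProperSystem S) :
    polar P G H = (polar P G.dual H.dual).dual.comap (tensorBidual G.space H.space) := by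
  refine System.ext_cone fun c => SetLike.ext fun z =>
    Iff.trans ⟨fun hz w hw => ?_, fun hz e he => ?_⟩ System.mem_comap_tensorBidual_dual.symm
  -- Here `w` is in the polar, hence in the clique, so `z` is compatible with it; evaluation is one
  -- of the admissible pairings.
  · exact hz _ (mem_of_mem_polar hP (hspan _ _ _) hw) _ G.system.positivePairing_dual _
      H.system.positivePairing_dual (𝟙 (starObj c))
  · intro α hα β hβ χ
    -- Read as completely positive maps into the dual systems, `α` and `β` together with `χ` carry
    -- `e` into the polar for `G.dual`, `H.dual`. Evaluating that image at `z` returns the given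
    -- pairing of `e` with `z`.
    have hw := map_mem_polar (mem_polar_of_mem hP he) (G' := G.dual) (H' := H.dual)
      ⟨α, hα.completelyPositive⟩ ⟨β, hβ.completelyPositive⟩ χ
    have h1 := hz _ hw
    have h2 := tensorPairing_map (tensorPairing
        (LinearMap.id : Module.Dual ℝ G.space →ₗ[ℝ] Module.Dual ℝ G.space)
        (LinearMap.id : Module.Dual ℝ H.space →ₗ[ℝ] Module.Dual ℝ H.space))
        (S.form (𝟙 (starObj c))) (TensorProduct.map α β) (S.map χ) LinearMap.id LinearMap.id
        e.vec z
    rw [TensorProduct.map_id, S.form_comp, Category.comp_id] at h2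
    refine h1.trans_eq (h2.trans ?_)
    congr 3
    ext
    simp

end TensorElement

end

end ConeSys

/-! ### The polar of a maximal clique as the required tensor product. -/

theorem mainTheorem2 {C : Type u} [Category.{v} C] [MonoidalCategory C] [SymmetricCategory C]
    [StarAutonomous C] (S : Stem C)
    (hproper : ∀ c : C, IsProperCone (S.intrinsicCone c))
    (hmul : ∀ c d : C,
      ((S.intrinsicCone c).minTensorProduct (S.intrinsicCone d)).map (S.mul c d).toLinearMap ≤
        S.intrinsicCone (c ⊗ d)) :
    ∃ T : SystemTensorProduct S,
      (∀ G H : ProperSystem S,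
        System.minTensor G.system H.system ≤ T.obj G H ∧
          T.obj G H ≤ System.maxTensor G.system H.system) ∧
      T.SelfDual := by
  obtain ⟨P, hPsub, hP⟩ :=
    TensorElement.exists_maximal_clique (TensorElement.isClique_products hmul)
  have hspan : ∀ G H c, Submodule.span ℝ (TensorElement.maximalCone hP G H c :
      Set ((G.space ⊗[ℝ] H.space) ⊗[ℝ] S.obj c)) = ⊤ := by
    intro G H c
    rw [eq_top_iff, ← TensorElement.span_products_eq_top (fun c => (hproper c).sharp) G H c]
    exact Submodule.span_mono fun z hz => hPsub hz
  have hdual := TensorElement.polar_eq_dual hP hspan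
  have hfull : ∀ G H c, FullCone ((TensorElement.polar P G H).cone c) := by
    intro G H c
    rw [fullCone_iff_span, eq_top_iff, ← hspan G H c]
    exact Submodule.span_mono fun z hz => TensorElement.mem_polar_of_mem hP hz
  have hsharp : ∀ G H c, SharpCone ((TensorElement.polar P G H).cone c) := by
    intro G H c
    -- By self-duality the cone is the dual of a full-dimensional one, hence sharp.
    rw [hdual]
    exact System.sharpCone_comap_dual (X := G.space ⊗[ℝ] H.space)
      (Z := G.dual.space ⊗[ℝ] H.dual.space) (K := TensorElement.polar P G.dual H.dual)
      (f := tensorBidual G.space H.space) (tensorBidual_injective G.space H.space)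
      (hfull G.dual H.dual (starObj c))
  have hmin : ∀ G H : ProperSystem S,
      System.minTensor G.system H.system ≤ TensorElement.polar P G H := by
    intro G H
    refine (System.isLeast_minTensor G.system H.system).2 fun c d => ?_
    have h : (G.system.cone c).minTensorProduct (H.system.cone d) ≤
        ((TensorElement.polar P G H).cone (c ⊗ d)).comap (S.mulTensor G.space H.space c d) := by
      refine Submodule.span_le.2 ?_
      rintro _ ⟨x, hx, y, hy, rfl⟩
      refine TensorElement.mem_polar_of_mem hP (hPsub ⟨G, H, _, c, d, 𝟙 _, x, hx, y, hy, ?_⟩)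
      have : S.map (𝟙 (c ⊗ d)) = LinearMap.id := LinearMap.ext fun s => S.map_id_apply s
      rw [this, LinearMap.lTensor_id]
      rfl
    rintro _ ⟨z, hz, rfl⟩
    exact h hz
  refine ⟨⟨TensorElement.polar P, fun G H => ⟨hfull G H _, hsharp G H _⟩, fun φ ψ c z hz => ?_⟩,
    fun G H => ⟨hmin G H, ?_⟩, hdual⟩
  · have h := TensorElement.map_mem_polar hz φ ψ (𝟙 c)
    have : S.map (𝟙 c) = LinearMap.id := LinearMap.ext fun s => S.map_id_apply s
    rw [this] at h
    exact h
  · change TensorElement.polar P G H ≤ _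
    rw [hdual]
    -- Dualizing the lower bound for `G.dual` and `H.dual` reverses the inclusion and gives the
    -- upper bound.
    exact fun c z hz w hw => hz (hmin G.dual H.dual _ hw)
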